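/- Let $s_\lambda=\sum_T x^T$ denote the Schur function of the partition $\lambda$ in the variables $x_1,x_2,\ldots$, summed over all semistandard Young tableaux $T$ of shape $\lambda$, and write $(\ldots,3^{m_3},2^{m_2},1^{m_1})$ for the partition with $m_i$ parts equal to $i$ (with $s_\emptyset=1$). By convention, $s_{(2^a,1^b)}=0$ whenever $a<0$ or $b<0$. For integers $0\le i\le m$ put $$D_{m,i}=s_{(2^i)}s_{(2^{m-i-1})}+s_{(2^{i-1},1^2)}s_{(2^{m-i-1})}-s_{(2^{i-1},1)}s_{(2^{m-i-1},1)}.$$ For partitions $\lambda,\mu$ let $\lambda\cup\mu$ be the partition obtained by taking all parts of $\lambda$ and $\mu$ together and rearranging them in weakly decreasing order. Since the Schur functions form a $\mathbb{Z}$-basis of the ring of symmetric functions with integer coefficients, one may define the linear operator $\Delta^{(2)}$ on this ring by $$\Delta^{(2)}\Big(\sum_\lambda a_\lambda s_\lambda\Big)=\sum_\lambda a_\lambda s_{\lambda\cup(2)}.$$ **Theorem.** Let $k\ge 0$ be an integer and $m=2k+1$. (i) We have $$D_{m,k}=s_{(3^k)}s_{(1^k)},\qquad D_{m,k+1}=s_{(4^k)}-s_{(3^k)}s_{(1^k)}-\Delta^{(2)}\big(s_{(3^k)}s_{(1^{k-2})}\big).$$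 (ii) For every integer $i$ with $0\le i\le k-1$, $$D_{m,i}=\Delta^{(2)}(D_{m-1,i}),\qquad D_{m,m-i}=\Delta^{(2)}(D_{m-1,m-1-i}).$$ -/

import Mathlib

noncomputable section

namespace SchurFn

/-- The Young diagram of the partition whose multiset of (nonzero) parts is `s`:
the parts are arranged in weakly decreasing order and taken as row lengths. -/
def diagram (s : Multiset ℕ) : YoungDiagram :=
  YoungDiagram.ofRowLens (s.sort (· ≥ ·)) (s.pairwise_sort (· ≥ ·)).sortedGE

/-- The multiset of nonzero parts of a partition. -/
def parts (l : YoungDiagram) : Multiset ℕ := (l.rowLens : Multiset ℕ)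

/-- The partition `l ∪ r`: put all parts of `l` and of `r` together and rearrange. -/
def union (l r : YoungDiagram) : YoungDiagram := diagram (parts l + parts r)

/-- The type of a semistandard tableau `T`: the exponent vector `α` of `x ^ T`, where `α i` is the
number of entries of `T` equal to `i`. As in Mathlib, the entries of tableaux, and accordingly the
indices of the variables, start from `0`. -/
def type {l : YoungDiagram} (T : SemistandardYoungTableau l) : ℕ →₀ ℕ :=
  ∑ c ∈ l.cells, Finsupp.single (T c.1 c.2) 1

/-- The Schur function `s_l = ∑_T x ^ T` in the variables `x₀, x₁, …`, as a formal power series: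
the coefficient of `x ^ α` is the number of semistandard tableaux of shape `l` and type `α`. -/
def schur (l : YoungDiagram) : MvPowerSeries ℕ ℤ :=
  fun α => (Nat.card {T : SemistandardYoungTableau l // type T = α} : ℤ)

theorem type_apply {l : YoungDiagram} (T : SemistandardYoungTableau l) (i : ℕ) :
    type T i = (l.cells.filter fun c => T c.1 c.2 = i).card := by
  classical
  rw [Finset.card_filter, type, Finsupp.finsetSum_apply]
  exact Finset.sum_congr rfl fun c _ => Finsupp.single_apply

/-- There are only finitely many tableaux of given shape and type, so `Nat.card` counts them. -/
theorem finite_type (l : YoungDiagram) (α : ℕ →₀ ℕ) :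
    Finite {T : SemistandardYoungTableau l // type T = α} := by
  classical
  have key : ∀ T : {T : SemistandardYoungTableau l // type T = α}, ∀ c : l.cells,
      T.1 c.1.1 c.1.2 ∈ α.support := by
    rintro ⟨T, rfl⟩ c
    rw [Finsupp.mem_support_iff, type_apply]
    exact Finset.card_ne_zero_of_mem (Finset.mem_filter.2 ⟨c.2, rfl⟩)
  refine Finite.of_injective
    (fun T => fun c : l.cells => (⟨T.1 c.1.1 c.1.2, key T c⟩ : α.support)) ?_
  intro T T' h
  apply Subtype.ext
  ext i j
  by_cases hc : (i, j) ∈ l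
  · have := congrFun h ⟨(i, j), (YoungDiagram.mem_cells _).2 hc⟩
    simpa using this
  · rw [T.1.zeros hc, T'.1.zeros hc]

theorem row_le_entry {l : YoungDiagram} (T : SemistandardYoungTableau l) (i j : ℕ)
    (h : (i, j) ∈ l) : i ≤ T i j := by
  induction i with
  | zero => exact Nat.zero_le _
  | succ i ih =>
    have h1 := ih (l.up_left_mem (Nat.le_succ i) le_rfl h)
    exact h1.trans_lt (T.col_strict (Nat.lt_succ_self i) h)

/-- The number of squares of `l` in the first `r` rows. -/
def top (l : YoungDiagram) (r : ℕ) : ℕ := (l.cells.filter fun c => c.1 < r).card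

theorem sum_type {l : YoungDiagram} (T : SemistandardYoungTableau l) (r : ℕ) :
    ∑ i ∈ Finset.range r, type T i = (l.cells.filter fun c => T c.1 c.2 < r).card := by
  classical
  rw [Finset.card_eq_sum_card_fiberwise (f := fun c => T c.1 c.2) (t := Finset.range r)]
  · refine Finset.sum_congr rfl fun i hi => ?_
    rw [type_apply, Finset.filter_filter]
    congr 1
    ext c
    simp only [Finset.mem_filter, Finset.mem_range] at hi ⊢
    grind
  · intro c hc
    simpa using (Finset.mem_filter.1 hc).2

theorem sum_type_highestWeight (l : YoungDiagram) (r : ℕ) :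
    ∑ i ∈ Finset.range r, type (SemistandardYoungTableau.highestWeight l) i = top l r := by
  rw [sum_type, top]
  congr 1
  apply Finset.filter_congr
  rintro ⟨i, j⟩ hc
  rw [SemistandardYoungTableau.highestWeight_apply, if_pos ((YoungDiagram.mem_cells _).1 hc)]

theorem filter_subset {l : YoungDiagram} (T : SemistandardYoungTableau l) (r : ℕ) :
    (l.cells.filter fun c => T c.1 c.2 < r) ⊆ l.cells.filter fun c => c.1 < r := by
  intro c hc
  rw [Finset.mem_filter] at hc ⊢
  exact ⟨hc.1, (row_le_entry T c.1 c.2 ((YoungDiagram.mem_cells _).1 hc.1)).trans_lt hc.2⟩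

theorem top_le {l r : YoungDiagram} (T : SemistandardYoungTableau r)
    (h : type T = type (SemistandardYoungTableau.highestWeight l)) : top l ≤ top r := by
  intro n
  rw [← sum_type_highestWeight, ← h, sum_type]
  exact Finset.card_le_card (filter_subset T n)

theorem eq_highestWeight {l : YoungDiagram} (T : SemistandardYoungTableau l)
    (h : type T = type (SemistandardYoungTableau.highestWeight l)) :
    T = SemistandardYoungTableau.highestWeight l := by
  ext i j
  rw [SemistandardYoungTableau.highestWeight_apply]
  split_ifs with hc
  · refine le_antisymm ?_ (row_le_entry T i j hc)
    have heq := Finset.eq_of_subset_of_card_le (filter_subset T (i + 1)) (by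
      rw [← sum_type, h, sum_type_highestWeight, top])
    have hm : (i, j) ∈ l.cells.filter fun c => c.1 < i + 1 :=
      Finset.mem_filter.2 ⟨(YoungDiagram.mem_cells _).2 hc, Nat.lt_succ_self i⟩
    rw [← heq, Finset.mem_filter] at hm
    exact Nat.lt_succ_iff.1 hm.2
  · exact T.zeros hc

theorem top_succ (l : YoungDiagram) (n : ℕ) : top l (n + 1) = top l n + l.rowLen n := by
  rw [YoungDiagram.rowLen_eq_card, YoungDiagram.row, top, top, ← Finset.card_union_of_disjoint]
  · congr 1
    ext c
    simp only [Finset.mem_filter, Finset.mem_union]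
    grind
  · rw [Finset.disjoint_left]
    intro c h1 h2
    have := (Finset.mem_filter.1 h1).2
    have := (Finset.mem_filter.1 h2).2
    omega

theorem top_injective : Function.Injective top := by
  intro l r h
  ext ⟨i, j⟩
  have h1 := top_succ l i
  have h2 := top_succ r i
  rw [h] at h1
  rw [YoungDiagram.mem_cells, YoungDiagram.mem_cells, YoungDiagram.mem_iff_lt_rowLen,
    YoungDiagram.mem_iff_lt_rowLen, show l.rowLen i = r.rowLen i by omega]

theorem coeff_self (l : YoungDiagram) :
    schur l (type (SemistandardYoungTableau.highestWeight l)) = 1 := by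
  have : Unique {T : SemistandardYoungTableau l //
      type T = type (SemistandardYoungTableau.highestWeight l)} :=
    { default := ⟨_, rfl⟩
      uniq := fun T => Subtype.ext (eq_highestWeight T.1 T.2) }
  simp [schur]

theorem coeff_eq_zero {l r : YoungDiagram} (h : ¬ top l ≤ top r) :
    schur r (type (SemistandardYoungTableau.highestWeight l)) = 0 := by
  have : IsEmpty {T : SemistandardYoungTableau r //
      type T = type (SemistandardYoungTableau.highestWeight l)} :=
    ⟨fun T => h (top_le T.1 T.2)⟩
  simp [schur]

theorem schur_linearIndependent : LinearIndependent ℤ schur := by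
  classical
  rw [linearIndependent_iff]
  intro a ha
  by_contra hne
  obtain ⟨l, hl⟩ := Finset.exists_maximalFor top a.support (Finsupp.support_nonempty_iff.2 hne)
  have h0 := congrArg
    (MvPowerSeries.coeff (type (SemistandardYoungTableau.highestWeight l))) ha
  rw [Finsupp.linearCombination_apply, Finsupp.sum, map_sum, map_zero,
    Finset.sum_eq_single_of_mem l hl.1] at h0
  · rw [map_smul, MvPowerSeries.coeff_apply, coeff_self, smul_eq_mul, mul_one] at h0
    exact (Finsupp.mem_support_iff.1 hl.1) h0
  · intro r hr hrl
    rw [map_smul, MvPowerSeries.coeff_apply, coeff_eq_zero, smul_zero]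
    intro hle
    exact hrl (top_injective (le_antisymm (hl.2 hr hle) hle))

/-- The symmetric functions with integer coefficients, as the `ℤ`-linear combinations of Schur
functions: the Schur functions are a `ℤ`-basis of the ring of symmetric functions. -/
def Sym : Submodule ℤ (MvPowerSeries ℕ ℤ) := Submodule.span ℤ (Set.range schur)

/-- The basis of Schur functions. -/
def schurBasis : Module.Basis YoungDiagram ℤ Sym := Module.Basis.span schur_linearIndependent

/-- The operator `Δ^μ` that takes `∑ a_l s_l` to `∑ a_l s_{l ∪ μ}`. -/
def Delta (μ : YoungDiagram) : Sym →ₗ[ℤ] Sym :=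
  schurBasis.constr ℤ fun l => schurBasis (union l μ)

theorem schurBasis_apply (l : YoungDiagram) :
    (schurBasis l : MvPowerSeries ℕ ℤ) = schur l :=
  congrArg Subtype.val (Module.Basis.span_apply schur_linearIndependent l)

theorem Delta_schurBasis (μ l : YoungDiagram) :
    Delta μ (schurBasis l) = schurBasis (union l μ) :=
  schurBasis.constr_basis ℤ _ l

/-- The rectangular Schur function `s_{(c^n)}` (with `n` parts equal to `c`). -/
def sRect (c n : ℕ) : MvPowerSeries ℕ ℤ := schur (diagram (Multiset.replicate n c))

/-- `s_{(2^a,1^b)}`, which is `0` by convention if `a < 0` or `b < 0`. -/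
def sTwoOne (a b : ℤ) : MvPowerSeries ℕ ℤ :=
  if a < 0 ∨ b < 0 then 0
  else schur (diagram (Multiset.replicate a.toNat 2 + Multiset.replicate b.toNat 1))

/-- `D_{m,i} = s_{(2^i)} s_{(2^{m-i-1})} + s_{(2^{i-1},1^2)} s_{(2^{m-i-1})}
  - s_{(2^{i-1},1)} s_{(2^{m-i-1},1)}`, for `0 ≤ i ≤ m`. -/
def D (m i : ℕ) : MvPowerSeries ℕ ℤ :=
  sTwoOne i 0 * sTwoOne ((m : ℤ) - i - 1) 0
    + sTwoOne ((i : ℤ) - 1) 2 * sTwoOne ((m : ℤ) - i - 1) 0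
    - sTwoOne ((i : ℤ) - 1) 1 * sTwoOne ((m : ℤ) - i - 1) 1

end SchurFn

end

noncomputable section

namespace SchurFn

/-! ### Diagrams with at most four columns -/

/-! Every partition involved has at most four columns, so its Schur function is a 4×4 determinant
`jt e p` in the elementary symmetric functions (`schur_ofCols`, the dual Jacobi–Trudi identity).
Both sides of that identity obey the same recursion in the number of variables: branching on the
largest entry for tableaux, multilinearity in the rows for the determinant.

A new row of length 2 lengthens the first two columns by one, so `Δ^(2)` sends `jt e p` to `jt e (p
+ (1,1,0,0))`. This survives for integer vectors α whose first two entries are ≥ M and whose last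
two are ≤ M, because straightening then takes place inside each pair (`isDelta_jt`). Products of
two-column functions are sums of such determinants: `jt` is obtained from the product by factors 1 -
R with R a raising operator, and these are inverted by finite sums, as `e` vanishes at negative
indices (`isDelta_of_diff`). Hence `Δ^(2)` of a product acts on its longer factor alone
(`isDelta_jt₂_mul_jt₂`), which gives (ii) term by term. Membership of the products in `Sym` comes
out of the same induction.

For (i), the first formula is a polynomial identity in the `e r`. So is the second, once
`isDelta_jt₃_mul_e` has computed its `Δ^(2)` term. -/

/-- The diagram whose columns have lengths `p 0 ≥ p 1 ≥ p 2 ≥ p 3`. -/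
def ofCols (p : Fin 4 → ℤ) : YoungDiagram where
  cells := Finset.univ.biUnion fun j : Fin 4 =>
    Finset.range (p j).toNat ×ˢ Finset.range ((j : ℕ) + 1)
  isLowerSet := by
    rintro ⟨i, j⟩ ⟨i', j'⟩ ⟨h1, h2⟩ h
    simp only [Finset.coe_biUnion, Set.mem_iUnion, Finset.mem_coe, Finset.mem_product,
      Finset.mem_range, Finset.mem_univ] at h ⊢
    obtain ⟨m, -, h3, h4⟩ := h
    exact ⟨m, trivial, lt_of_le_of_lt h1 h3, lt_of_le_of_lt h2 h4⟩

theorem mem_ofCols {p : Fin 4 → ℤ} (hp : Antitone p) {i j : ℕ} :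
    (i, j) ∈ ofCols p ↔ ∃ h : j < 4, (i : ℤ) < p ⟨j, h⟩ := by
  rw [← YoungDiagram.mem_cells]
  simp only [ofCols, Finset.mem_biUnion, Finset.mem_univ, true_and, Finset.mem_product,
    Finset.mem_range]
  constructor
  · rintro ⟨m, h1, h2⟩
    have hj : j < 4 := by omega
    refine ⟨hj, ?_⟩
    have := hp (show (⟨j, hj⟩ : Fin 4) ≤ m from Fin.le_def.2 (by simp; omega))
    omega
  · rintro ⟨h, h1⟩
    exact ⟨⟨j, h⟩, by omega, by simp⟩

/-- The column lengths after the bottom squares of the columns in `s` have been removed. -/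
def dropCols (p : Fin 4 → ℤ) (s : Finset (Fin 4)) (j : Fin 4) : ℤ := p j - if j ∈ s then 1 else 0

/-- `p` is the sequence of column lengths of a diagram. -/
def IsCols (p : Fin 4 → ℤ) : Prop := Antitone p ∧ 0 ≤ p 3

theorem IsCols.nonneg {p : Fin 4 → ℤ} (hp : IsCols p) (j : Fin 4) : 0 ≤ p j :=
  hp.2.trans (hp.1 (Fin.le_last j))

open Classical in
/-- The columns that contain the entry `n`. -/
def colsWith {l : YoungDiagram} (T : SemistandardYoungTableau l) (n : ℕ) : Finset (Fin 4) :=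
  Finset.univ.filter fun j => ∃ i : ℕ, (i, (j : ℕ)) ∈ l ∧ T i j = n

theorem mem_colsWith {l : YoungDiagram} {T : SemistandardYoungTableau l} {n : ℕ} {j : Fin 4} :
    j ∈ colsWith T n ↔ ∃ i : ℕ, (i, (j : ℕ)) ∈ l ∧ T i j = n := by
  simp [colsWith]

theorem entry_lt {l : YoungDiagram} {T : SemistandardYoungTableau l} {n : ℕ}
    (hT : (type T).support ⊆ Finset.range n) {i j : ℕ} (h : (i, j) ∈ l) : T i j < n := by
  refine Finset.mem_range.1 (hT ?_)
  rw [Finsupp.mem_support_iff, type_apply]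
  exact Finset.card_ne_zero_of_mem (Finset.mem_filter.2 ⟨(YoungDiagram.mem_cells (i, j)).2 h, rfl⟩)

/-- Columns increase strictly, so each column contains a given entry at most once. -/
theorem type_apply_eq_card {p : Fin 4 → ℤ} (hp : Antitone p)
    (T : SemistandardYoungTableau (ofCols p)) (n : ℕ) : type T n = (colsWith T n).card := by
  classical
  rw [type_apply]
  refine Finset.card_bij' (s := Finset.filter _ _)
    (fun c _ => if h : c.2 < 4 then (⟨c.2, h⟩ : Fin 4) else 0)
    (fun j h => ((mem_colsWith.1 h).choose, (j : ℕ))) ?_ ?_ ?_ ?_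
  · rintro ⟨i, j⟩ hc
    obtain ⟨h1, h2⟩ := Finset.mem_filter.1 hc
    have h1 := (YoungDiagram.mem_cells _).1 h1
    obtain ⟨h3, -⟩ := (mem_ofCols hp).1 h1
    simp only [h3, dite_true]
    exact mem_colsWith.2 ⟨i, h1, h2⟩
  · intro j hj
    have := (mem_colsWith.1 hj).choose_spec
    exact Finset.mem_filter.2 ⟨(YoungDiagram.mem_cells _).2 this.1, this.2⟩
  · rintro ⟨i, j⟩ hc
    obtain ⟨h1, h2⟩ := Finset.mem_filter.1 hc
    have h1 := (YoungDiagram.mem_cells _).1 h1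
    obtain ⟨h3, -⟩ := (mem_ofCols hp).1 h1
    have hm : (⟨j, h3⟩ : Fin 4) ∈ colsWith T n := mem_colsWith.2 ⟨i, h1, h2⟩
    have hs := (mem_colsWith.1 hm).choose_spec
    simp only [h3, dite_true, Prod.mk.injEq, and_true]
    generalize (mem_colsWith.1 hm).choose = i' at hs ⊢
    simp only at hs h2
    rcases lt_trichotomy i' i with h | h | h
    · have := T.col_strict h h1
      omega
    · exact h
    · have := T.col_strict h hs.1
      omega
  · intro j hj
    simp

/-! ### Branching: removing the squares with the largest entry -/

section Branching

variable {p : Fin 4 → ℤ} {n : ℕ} {α : ℕ →₀ ℕ}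

/-- As `n` is the largest possible entry, strictness puts it only at the bottom of a column. -/
theorem entry_lt_iff (hp : IsCols p) {T : SemistandardYoungTableau (ofCols p)}
    (hT : (type T).support ⊆ Finset.range (n + 1)) {i : ℕ} {j : Fin 4}
    (h : (i, (j : ℕ)) ∈ ofCols p) : T i j < n ↔ (i : ℤ) < dropCols p (colsWith T n) j := by
  have hi : (i : ℤ) < p j := ((mem_ofCols hp.1).1 h).2
  constructor
  · intro hlt
    rw [dropCols]
    split_ifs with hs
    · obtain ⟨i', h1, h2⟩ := mem_colsWith.1 hs
      have hi' : (i' : ℤ) < p j := ((mem_ofCols hp.1).1 h1).2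
      have : i < i' := by
        by_contra hle
        have := T.col_weak (not_lt.1 hle) h
        omega
      omega
    · omega
  · intro hlt
    by_contra hle
    have he : T i j = n := le_antisymm (Nat.lt_succ_iff.1 (entry_lt hT h)) (not_lt.1 hle)
    have hs : j ∈ colsWith T n := mem_colsWith.2 ⟨i, h, he⟩
    rw [dropCols, if_pos hs] at hlt
    have h' : (i + 1, (j : ℕ)) ∈ ofCols p :=
      (mem_ofCols hp.1).2 ⟨j.2, by simp only [Fin.eta]; push_cast; omega⟩
    have h1 := T.col_strict i.lt_add_one h'
    have h2 := entry_lt hT h'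
    omega

/-- Monotonicity could fail only for columns of equal length with the right one shortened less. If
the left one ends in `n`, weak increase along the bottom row makes the right one end in `n` too. -/
theorem isCols_dropCols (hp : IsCols p) {T : SemistandardYoungTableau (ofCols p)}
    (hT : (type T).support ⊆ Finset.range (n + 1)) : IsCols (dropCols p (colsWith T n)) := by
  constructor
  · intro j j' hj
    have h1 := hp.1 hj
    rcases hj.eq_or_lt with rfl | hlt
    · exact le_rfl
    rw [dropCols, dropCols]
    split_ifs with h2 h3 h3
    · omega
    · omega
    · obtain ⟨i, h4, h5⟩ := mem_colsWith.1 h3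
      have h6 : (i : ℤ) < p j := ((mem_ofCols hp.1).1 h4).2
      by_contra hlt'
      have h7 : (i, (j' : ℕ)) ∈ ofCols p :=
        (mem_ofCols hp.1).2 ⟨j'.2, by simp only [Fin.eta]; omega⟩
      have h8 := T.row_weak (show (j : ℕ) < j' from hlt) h7
      have h9 := entry_lt hT h7
      exact h2 (mem_colsWith.2 ⟨i, h7, by omega⟩)
    · omega
  · have h0 := hp.2
    rw [dropCols]
    split_ifs with h
    · obtain ⟨i, h4, h5⟩ := mem_colsWith.1 h
      have h6 : (i : ℤ) < p 3 := ((mem_ofCols hp.1).1 h4).2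
      omega
    · omega

theorem dropCols_le (p : Fin 4 → ℤ) (s : Finset (Fin 4)) (j : Fin 4) : dropCols p s j ≤ p j := by
  rw [dropCols]
  split_ifs <;> omega

theorem mem_of_mem_dropCols (hp : IsCols p) {s : Finset (Fin 4)} (hs : IsCols (dropCols p s))
    {i j : ℕ} (h : (i, j) ∈ ofCols (dropCols p s)) : (i, j) ∈ ofCols p := by
  obtain ⟨h1, h2⟩ := (mem_ofCols hs.1).1 h
  exact (mem_ofCols hp.1).2 ⟨h1, h2.trans_le (dropCols_le p s _)⟩

theorem mem_dropCols_iff (hp : IsCols p) {T : SemistandardYoungTableau (ofCols p)}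
    (hT : (type T).support ⊆ Finset.range (n + 1)) {i j : ℕ} :
    (i, j) ∈ ofCols (dropCols p (colsWith T n)) ↔ (i, j) ∈ ofCols p ∧ T i j < n := by
  have hs := isCols_dropCols hp hT
  constructor
  · intro h
    have h' := mem_of_mem_dropCols hp hs h
    obtain ⟨h1, h2⟩ := (mem_ofCols hs.1).1 h
    exact ⟨h', (entry_lt_iff hp hT (j := ⟨j, h1⟩) h').2 h2⟩
  · rintro ⟨h1, h2⟩
    have h3 := ((mem_ofCols hp.1).1 h1).1
    exact (mem_ofCols hs.1).2 ⟨h3, (entry_lt_iff hp hT (j := ⟨j, h3⟩) h1).1 h2⟩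

/-- Remove the squares with entry `n`. -/
def removeLast (T : SemistandardYoungTableau (ofCols p)) (s : Finset (Fin 4)) (hp : IsCols p)
    (hs : IsCols (dropCols p s)) : SemistandardYoungTableau (ofCols (dropCols p s)) where
  entry i j := by
    classical exact if (i, j) ∈ ofCols (dropCols p s) then T i j else 0
  row_weak' hj h := by
    rw [if_pos h, if_pos ((ofCols _).up_left_mem le_rfl hj.le h)]
    exact T.row_weak hj (mem_of_mem_dropCols hp hs h)
  col_strict' hi h := by
    rw [if_pos h, if_pos ((ofCols _).up_left_mem hi.le le_rfl h)]
    exact T.col_strict hi (mem_of_mem_dropCols hp hs h)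
  zeros' h := if_neg h

open Classical in
theorem removeLast_apply (T : SemistandardYoungTableau (ofCols p)) (s : Finset (Fin 4))
    (hp : IsCols p) (hs : IsCols (dropCols p s)) (i j : ℕ) :
    removeLast T s hp hs i j = if (i, j) ∈ ofCols (dropCols p s) then T i j else 0 := by
  rw [← SemistandardYoungTableau.to_fun_eq_coe]
  rfl

theorem mem_dropCols_of_lt (hp : IsCols p) {s : Finset (Fin 4)} (hs : IsCols (dropCols p s))
    {i i' j : ℕ} (hi : i < i') (h : (i', j) ∈ ofCols p) : (i, j) ∈ ofCols (dropCols p s) := by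
  obtain ⟨h1, h2⟩ := (mem_ofCols hp.1).1 h
  refine (mem_ofCols hs.1).2 ⟨h1, ?_⟩
  rw [dropCols]
  split_ifs <;> omega

/-- Fill the new squares with the entry `n`. -/
def addLast {s : Finset (Fin 4)} (T : SemistandardYoungTableau (ofCols (dropCols p s)))
    (hp : IsCols p) (hs : IsCols (dropCols p s)) (hT : (type T).support ⊆ Finset.range n) :
    SemistandardYoungTableau (ofCols p) where
  entry i j := by
    classical exact if (i, j) ∈ ofCols (dropCols p s) then T i j
      else if (i, j) ∈ ofCols p then n else 0
  row_weak' {i j1 j2} hj h := by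
    by_cases h' : (i, j2) ∈ ofCols (dropCols p s)
    · rw [if_pos h', if_pos ((ofCols _).up_left_mem le_rfl hj.le h')]
      exact T.row_weak hj h'
    · rw [if_neg h', if_pos h]
      split_ifs with h1 h2
      · exact (entry_lt hT h1).le
      · exact le_rfl
      · exact Nat.zero_le _
  col_strict' {i1 i2 j} hi h := by
    rw [if_pos (mem_dropCols_of_lt hp hs hi h)]
    by_cases h' : (i2, j) ∈ ofCols (dropCols p s)
    · rw [if_pos h']
      exact T.col_strict hi h'
    · rw [if_neg h', if_pos h]
      exact entry_lt hT (mem_dropCols_of_lt hp hs hi h)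
  zeros' h := by
    rw [if_neg fun h' => h (mem_of_mem_dropCols hp hs h'), if_neg h]

open Classical in
theorem addLast_apply {s : Finset (Fin 4)} (T : SemistandardYoungTableau (ofCols (dropCols p s)))
    (hp : IsCols p) (hs : IsCols (dropCols p s)) (hT : (type T).support ⊆ Finset.range n)
    (i j : ℕ) : addLast T hp hs hT i j = if (i, j) ∈ ofCols (dropCols p s) then T i j
      else if (i, j) ∈ ofCols p then n else 0 := by
  rw [← SemistandardYoungTableau.to_fun_eq_coe]
  rfl

theorem colsWith_addLast {s : Finset (Fin 4)}
    (T : SemistandardYoungTableau (ofCols (dropCols p s)))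
    (hp : IsCols p) (hs : IsCols (dropCols p s)) (hT : (type T).support ⊆ Finset.range n) :
    colsWith (addLast T hp hs hT) n = s := by
  ext j
  rw [mem_colsWith]
  have h0 := hs.nonneg j
  rw [dropCols] at h0
  constructor
  · rintro ⟨i, h1, h2⟩
    by_contra hj
    have : (i, (j : ℕ)) ∈ ofCols (dropCols p s) := by
      refine (mem_ofCols hs.1).2 ⟨j.2, ?_⟩
      rw [Fin.eta, dropCols, if_neg hj, sub_zero]
      exact ((mem_ofCols hp.1).1 h1).2
    rw [addLast_apply, if_pos this] at h2
    exact (entry_lt hT this).ne h2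
  · intro hj
    rw [if_pos hj] at h0
    have h1 : ((p j - 1).toNat, (j : ℕ)) ∈ ofCols p :=
      (mem_ofCols hp.1).2 ⟨j.2, by rw [Fin.eta]; omega⟩
    refine ⟨(p j - 1).toNat, h1, ?_⟩
    rw [addLast_apply, if_neg, if_pos h1]
    rw [mem_ofCols hs.1]
    rintro ⟨h2, h3⟩
    rw [Fin.eta, dropCols, if_pos hj] at h3
    omega

theorem type_removeLast (hp : IsCols p) {T : SemistandardYoungTableau (ofCols p)}
    (hT : (type T).support ⊆ Finset.range (n + 1)) :
    type (removeLast T _ hp (isCols_dropCols hp hT)) = (type T).erase n := by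
  have hs := isCols_dropCols hp hT
  ext k
  rw [type_apply]
  rcases eq_or_ne k n with rfl | hk
  · rw [Finsupp.erase_same, Finset.card_eq_zero, Finset.filter_eq_empty_iff]
    rintro ⟨i, j⟩ hc
    have hc := (YoungDiagram.mem_cells _).1 hc
    rw [removeLast_apply, if_pos hc]
    exact ((mem_dropCols_iff hp hT).1 hc).2.ne
  · rw [Finsupp.erase_ne hk, type_apply]
    congr 1
    ext ⟨i, j⟩
    simp only [Finset.mem_filter, YoungDiagram.mem_cells, removeLast_apply]
    constructor
    · rintro ⟨h1, h2⟩
      rw [if_pos h1] at h2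
      exact ⟨mem_of_mem_dropCols hp hs h1, h2⟩
    · rintro ⟨h1, h2⟩
      have h3 := entry_lt hT h1
      have h4 := (mem_dropCols_iff hp hT (i := i) (j := j)).2 ⟨h1, by omega⟩
      exact ⟨h4, by rw [if_pos h4]; exact h2⟩

theorem type_addLast {s : Finset (Fin 4)} (T : SemistandardYoungTableau (ofCols (dropCols p s)))
    (hp : IsCols p) (hs : IsCols (dropCols p s)) (hT : (type T).support ⊆ Finset.range n)
    (hα : type T = α.erase n) (hn : s.card = α n) : type (addLast T hp hs hT) = α := by
  ext k
  rcases eq_or_ne k n with rfl | hk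
  · rw [type_apply_eq_card hp.1, colsWith_addLast, hn]
  · rw [← Finsupp.erase_ne (f := α) hk, ← hα, type_apply, type_apply]
    congr 1
    ext ⟨i, j⟩
    simp only [Finset.mem_filter, YoungDiagram.mem_cells, addLast_apply]
    constructor
    · rintro ⟨h1, h2⟩
      by_cases h3 : (i, j) ∈ ofCols (dropCols p s)
      · rw [if_pos h3] at h2
        exact ⟨h3, h2⟩
      · rw [if_neg h3, if_pos h1] at h2
        exact absurd h2.symm hk
    · rintro ⟨h1, h2⟩
      rw [if_pos h1]
      exact ⟨mem_of_mem_dropCols hp hs h1, h2⟩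

theorem support_erase_subset (hα : α.support ⊆ Finset.range (n + 1)) :
    (α.erase n).support ⊆ Finset.range n := by
  rw [Finsupp.support_erase]
  intro k hk
  rw [Finset.mem_erase] at hk
  have := Finset.mem_range.1 (hα hk.2)
  exact Finset.mem_range.2 (by omega)

/-- `removeLast` and `addLast` are mutually inverse. -/
theorem card_colsWith_eq (hp : IsCols p) {s : Finset (Fin 4)} (hs : IsCols (dropCols p s))
    (hα : α.support ⊆ Finset.range (n + 1)) (hn : s.card = α n) :
    Nat.card {T : {T : SemistandardYoungTableau (ofCols p) // type T = α} // colsWith T.1 n = s} =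
      Nat.card {T : SemistandardYoungTableau (ofCols (dropCols p s)) // type T = α.erase n} := by
  have hT' : ∀ T : {T : SemistandardYoungTableau (ofCols (dropCols p s)) // type T = α.erase n},
      (type T.1).support ⊆ Finset.range n := fun T => by
    rw [T.2]
    exact support_erase_subset hα
  refine Nat.card_congr
    { toFun := fun T => ⟨removeLast T.1.1 s hp hs, ?_⟩
      invFun := fun T => ⟨⟨addLast T.1 hp hs (hT' T), type_addLast _ hp hs _ T.2 hn⟩,
        colsWith_addLast _ hp hs (hT' T)⟩
      left_inv := ?_
      right_inv := ?_ }
  · obtain ⟨⟨T, rfl⟩, rfl⟩ := T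
    exact type_removeLast hp hα
  · rintro ⟨⟨T, rfl⟩, rfl⟩
    apply Subtype.ext
    apply Subtype.ext
    ext i j
    simp only [addLast_apply, removeLast_apply]
    split_ifs with h1 h2
    · rfl
    · have h3 := entry_lt hα h2
      have h4 := mt (mem_dropCols_iff hp hα).2 h1
      have h5 : ¬ T i j < n := fun h => h4 ⟨h2, h⟩
      omega
    · exact (T.zeros h2).symm
  · rintro ⟨T, hT⟩
    apply Subtype.ext
    ext i j
    simp only [addLast_apply, removeLast_apply]
    split_ifs with h1
    · rfl
    · exact (T.zeros h1).symm

open Classical in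
/-- Classify the tableaux by the squares with the largest entry `n`. -/
theorem schur_apply_eq_sum (hp : IsCols p) (hα : α.support ⊆ Finset.range (n + 1)) :
    schur (ofCols p) α = ∑ s : Finset (Fin 4), if IsCols (dropCols p s) ∧ s.card = α n then
      schur (ofCols (dropCols p s)) (α.erase n) else 0 := by
  have := finite_type (ofCols p) α
  rw [schur, ← Nat.card_congr (Equiv.sigmaFiberEquiv fun T :
    {T : SemistandardYoungTableau (ofCols p) // type T = α} => colsWith T.1 n), Nat.card_sigma]
  push_cast
  refine Finset.sum_congr rfl fun s _ => ?_
  split_ifs with h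
  · rw [card_colsWith_eq hp h.1 hα h.2, schur]
  · rw [Nat.cast_eq_zero]
    have : IsEmpty {T : {T : SemistandardYoungTableau (ofCols p) // type T = α} //
        colsWith T.1 n = s} := by
      constructor
      rintro ⟨⟨T, rfl⟩, rfl⟩
      exact h ⟨isCols_dropCols hp hα, (type_apply_eq_card hp.1 T n).symm⟩
    exact Nat.card_of_isEmpty

end Branching

/-! ### The dual Jacobi–Trudi identity -/

open Classical in
/-- The terms of a power series in the variables `x_i` with `i < n`. -/
def truncFun (n : ℕ) (f : MvPowerSeries ℕ ℤ) : MvPowerSeries ℕ ℤ :=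
  fun α => if α.support ⊆ Finset.range n then f α else 0

open Classical in
theorem coeff_truncFun (n : ℕ) (f : MvPowerSeries ℕ ℤ) (α : ℕ →₀ ℕ) :
    MvPowerSeries.coeff α (truncFun n f) =
      if α.support ⊆ Finset.range n then MvPowerSeries.coeff α f else 0 :=
  rfl

/-- The homomorphism of power series that sends the variables `x_i` with `n ≤ i` to `0`. -/
def trunc (n : ℕ) : MvPowerSeries ℕ ℤ →+* MvPowerSeries ℕ ℤ where
  toFun := truncFun n
  map_one' := by
    ext α
    rw [coeff_truncFun, MvPowerSeries.coeff_one]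
    by_cases h : α = 0
    · simp [h]
    · simp [h]
  map_mul' f g := by
    ext α
    rw [coeff_truncFun, MvPowerSeries.coeff_mul, MvPowerSeries.coeff_mul]
    simp only [coeff_truncFun]
    split_ifs with h
    · refine Finset.sum_congr rfl fun c hc => ?_
      rw [← Finset.HasAntidiagonal.mem_antidiagonal.1 hc] at h
      rw [if_pos, if_pos]
      · exact (Finsupp.support_mono le_add_self).trans h
      · exact (Finsupp.support_mono le_self_add).trans h
    · symm
      refine Finset.sum_eq_zero fun c hc => ?_
      rw [← Finset.HasAntidiagonal.mem_antidiagonal.1 hc] at h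
      by_cases h1 : c.1.support ⊆ Finset.range n
      · rw [if_neg (c := c.2.support ⊆ _), mul_zero]
        exact fun h2 => h (Finsupp.support_add.trans (Finset.union_subset h1 h2))
      · rw [if_neg h1, zero_mul]
  map_zero' := by
    ext α
    rw [coeff_truncFun, map_zero, ite_self]
  map_add' f g := by
    ext α
    rw [coeff_truncFun, map_add, map_add, coeff_truncFun, coeff_truncFun]
    split_ifs <;> simp

open Classical in
theorem coeff_trunc (n : ℕ) (f : MvPowerSeries ℕ ℤ) (α : ℕ →₀ ℕ) :
    MvPowerSeries.coeff α (trunc n f) = if α.support ⊆ Finset.range n then f α else 0 :=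
  rfl

/-- Each monomial involves finitely many variables, so some truncation retains it. -/
theorem eq_of_trunc_eq {f g : MvPowerSeries ℕ ℤ} (h : ∀ n, trunc n f = trunc n g) : f = g := by
  ext α
  have hα : α.support ⊆ Finset.range (α.support.sup id + 1) := fun i hi =>
    Finset.mem_range.2 (Nat.lt_succ_iff.2 (Finset.le_sup (f := id) hi))
  have := congrArg (MvPowerSeries.coeff α) (h (α.support.sup id + 1))
  rwa [coeff_trunc, coeff_trunc, if_pos hα, if_pos hα] at this

open Classical in
theorem coeff_X_pow_mul_trunc (n c : ℕ) (f : MvPowerSeries ℕ ℤ) (α : ℕ →₀ ℕ) :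
    MvPowerSeries.coeff α (MvPowerSeries.X n ^ c * trunc n f) =
      if α.support ⊆ Finset.range (n + 1) ∧ c = α n then f (α.erase n) else 0 := by
  rw [MvPowerSeries.X_pow_eq, MvPowerSeries.coeff_monomial_mul, coeff_trunc, one_mul]
  split_ifs with h1 h2 h3 h3 h3
  · rw [h3.2]
    congr 1
    ext k
    rcases eq_or_ne k n with rfl | hk
    · simp
    · simp [Finsupp.erase_ne hk, Finsupp.single_eq_of_ne hk]
  · exfalso
    refine h3 ⟨fun k hk => ?_, ?_⟩
    · rcases eq_or_ne k n with rfl | hkn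
      · simp
      · have : k ∈ (α - Finsupp.single n c).support := by
          simpa [Finsupp.single_eq_of_ne hkn] using hk
        have := Finset.mem_range.1 (h2 this)
        exact Finset.mem_range.2 (by omega)
    · have h4 := h1 n
      rw [Finsupp.single_eq_same] at h4
      by_contra hne
      have : n ∈ (α - Finsupp.single n c).support := by
        simp
        omega
      simpa using h2 this
  · exfalso
    refine h2 fun k hk => ?_
    rcases eq_or_ne k n with rfl | hkn
    · simp [h3.2] at hk
    · have : k ∈ α.support := by
        simpa [Finsupp.single_eq_of_ne hkn] using hk
      have := Finset.mem_range.1 (h3.1 this)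
      exact Finset.mem_range.2 (by omega)
  · rfl
  · exact absurd (Finsupp.single_le_iff.2 h3.2.le) h1
  · rfl

-- Generating-function form of the branching rule; it matches `jt_add` term by term.
open Classical in
theorem trunc_succ_schur {p : Fin 4 → ℤ} (hp : IsCols p) (n : ℕ) :
    trunc (n + 1) (schur (ofCols p)) = ∑ s : Finset (Fin 4), if IsCols (dropCols p s) then
      MvPowerSeries.X n ^ s.card * trunc n (schur (ofCols (dropCols p s))) else 0 := by
  ext α
  rw [coeff_trunc, map_sum]
  have hterm : ∀ s : Finset (Fin 4), MvPowerSeries.coeff α (if IsCols (dropCols p s) then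
      MvPowerSeries.X n ^ s.card * trunc n (schur (ofCols (dropCols p s))) else 0) =
      if IsCols (dropCols p s) then if α.support ⊆ Finset.range (n + 1) ∧ s.card = α n then
        schur (ofCols (dropCols p s)) (α.erase n) else 0 else 0 := by
    intro s
    by_cases h1 : IsCols (dropCols p s)
    · rw [if_pos h1, if_pos h1, coeff_X_pow_mul_trunc]
    · rw [if_neg h1, if_neg h1, map_zero]
  simp only [hterm]
  split_ifs with h
  · rw [schur_apply_eq_sum hp h]
    refine Finset.sum_congr rfl fun s _ => ?_
    simp only [h, true_and, ite_and]
  · simp [h]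

/-- The elementary symmetric functions, extended by `0` to negative indices. -/
def e (r : ℤ) : MvPowerSeries ℕ ℤ := if r < 0 then 0 else schur (ofCols ![r, 0, 0, 0])

theorem e_of_neg {r : ℤ} (h : r < 0) : e r = 0 := if_pos h

theorem isCols_iff {p : Fin 4 → ℤ} :
    IsCols p ↔ p 1 ≤ p 0 ∧ p 2 ≤ p 1 ∧ p 3 ≤ p 2 ∧ 0 ≤ p 3 := by
  constructor
  · rintro ⟨h, h0⟩
    exact ⟨h (by decide), h (by decide), h (by decide), h0⟩
  · rintro ⟨h0, h1, h2, h3⟩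
    refine ⟨Fin.antitone_iff_succ_le.2 fun i => ?_, h3⟩
    fin_cases i
    · exact h0
    · exact h1
    · exact h2

/-- The one-column case of branching, and the recursion that `jt_add` takes as its hypothesis. -/
theorem trunc_succ_e (n : ℕ) (r : ℤ) :
    trunc (n + 1) (e r) = trunc n (e r) + MvPowerSeries.X n * trunc n (e (r - 1)) := by
  classical
  rcases lt_or_ge r 0 with hr | hr
  · rw [e_of_neg hr, e_of_neg (by omega)]
    simp
  have hp : IsCols ![r, 0, 0, 0] := isCols_iff.2 (by simp [hr])
  have h0 : dropCols ![r, 0, 0, 0] ∅ = ![r, 0, 0, 0] := by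
    ext j
    simp [dropCols]
  have h1 : dropCols ![r, 0, 0, 0] {0} = ![r - 1, 0, 0, 0] := by
    ext j
    fin_cases j <;> simp [dropCols]
  rw [e, if_neg hr.not_gt, trunc_succ_schur hp, ← Finset.sum_subset
    (Finset.subset_univ ({∅, {0}} : Finset (Finset (Fin 4)))), Finset.sum_pair (by simp), h0, h1,
    if_pos hp]
  · congr 1
    · simp
    · rw [e]
      rcases hr.eq_or_lt with rfl | hr
      · rw [if_neg, if_pos (by norm_num)]
        · simp
        · rw [isCols_iff]
          simp
      · rw [if_pos, if_neg (by omega)]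
        · simp
        · rw [isCols_iff]
          simp
          omega
  · intro s _ hs
    rw [if_neg]
    rintro ⟨h2, h3⟩
    have h4 : ∀ j : Fin 4, j ≠ 0 → j ∉ s := by
      intro j hj hjs
      have h5 := h3.trans (h2 (Fin.le_last j))
      have h6 : (![r, 0, 0, 0] : Fin 4 → ℤ) j = 0 := by
        fin_cases j
        · exact absurd rfl hj
        all_goals rfl
      rw [dropCols, if_pos hjs, h6] at h5
      omega
    have h5 : s ⊆ {0} := fun j hj => by
      by_contra h
      exact h4 j (by simpa using h) hj
    rcases Finset.subset_singleton_iff.1 h5 with h | h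
    · simp [h] at hs
    · simp [h] at hs

/-! ### Linear algebra of the Jacobi–Trudi determinant -/

section JacobiTrudi

variable {R : Type*} [CommRing R]

/-- The determinant of the dual Jacobi–Trudi identity for four columns of lengths `p`. -/
def jt (f : ℤ → R) (p : Fin 4 → ℤ) : R := (Matrix.of fun i j : Fin 4 => f (p i - i + j)).det

theorem jt_eq_zero_of_neg {f : ℤ → R} (hf : ∀ r < 0, f r = 0) {p : Fin 4 → ℤ} (h : p 3 < 0) :
    jt f p = 0 := by
  refine Matrix.det_eq_zero_of_row_eq_zero 3 fun j => ?_
  have : (j : ℕ) < 4 := j.2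
  refine hf _ ?_
  simp only [Fin.coe_ofNat_eq_mod]
  omega

theorem jt_eq_zero_of_sub_eq {f : ℤ → R} {p : Fin 4 → ℤ} {i i' : Fin 4} (hi : i ≠ i')
    (h : p i - i = p i' - i') : jt f p = 0 := by
  refine Matrix.det_zero_of_row_eq hi ?_
  ext j
  simp only [Matrix.of_apply, h]

/-- Each row for `g` is the row for `f` plus `x` times the row for `f` with `p i` lowered by one.
Expanding multilinearly, `s` records the rows where the second summand is chosen. -/
theorem jt_add {f g : ℤ → R} {x : R} (h : ∀ r, g r = f r + x * f (r - 1)) (p : Fin 4 → ℤ) :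
    jt g p = ∑ s : Finset (Fin 4), x ^ s.card * jt f (dropCols p s) := by
  have h1 : (fun i j : Fin 4 => g (p i - i + j)) =
      (fun i j : Fin 4 => x * f (p i - i + j - 1)) + fun i j : Fin 4 => f (p i - i + j) := by
    ext i j
    rw [Pi.add_apply, Pi.add_apply, h, add_comm]
  have h2 := (Matrix.detRowAlternating (R := R) (n := Fin 4)).map_add_univ
    (fun i j : Fin 4 => x * f (p i - i + j - 1)) (fun i j : Fin 4 => f (p i - i + j))
  rw [← h1] at h2
  refine h2.trans (Finset.sum_congr rfl fun s _ => ?_)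
  have h3 : (s.piecewise (fun i j : Fin 4 => x * f (p i - i + j - 1))
      fun i j : Fin 4 => f (p i - i + j)) = Matrix.of fun i j : Fin 4 =>
      (if i ∈ s then x else 1) * f (dropCols p s i - i + j) := by
    ext i j
    by_cases hi : i ∈ s
    · simp only [Finset.piecewise_eq_of_mem _ _ _ hi, Matrix.of_apply, dropCols, if_pos hi]
      congr 2
      ring
    · simp [dropCols, hi]
  have h4 := Matrix.det_mul_column (fun i => if i ∈ s then x else 1)
    (Matrix.of fun i j : Fin 4 => f (dropCols p s i - i + j))
  rw [Finset.prod_ite_mem, Finset.univ_inter, Finset.prod_const] at h4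
  rw [h3]
  exact h4

end JacobiTrudi

theorem map_jt {R S : Type*} [CommRing R] [CommRing S] (φ : R →+* S) (f : ℤ → R)
    (p : Fin 4 → ℤ) : φ (jt f p) = jt (fun r => φ (f r)) p :=
  RingHom.map_det φ _

/-- The terms absent from the branching rule must vanish: an invalid removal either makes two
neighbouring rows equal or makes the last row zero. -/
theorem jt_dropCols_eq_zero {R : Type*} [CommRing R] {f : ℤ → R} (hf : ∀ r < 0, f r = 0)
    {p : Fin 4 → ℤ} (hp : IsCols p) {s : Finset (Fin 4)} (hs : ¬ IsCols (dropCols p s)) :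
    jt f (dropCols p s) = 0 := by
  -- Each length drops by at most one, so an inversion created by the removal has size exactly one,
  -- which is the case of equal rows.
  have key : ∀ i i' : Fin 4, p i' ≤ p i → dropCols p s i < dropCols p s i' →
      dropCols p s i' = dropCols p s i + 1 := by
    intro i i' h h'
    rw [dropCols, dropCols] at h' ⊢
    split_ifs at h' ⊢ <;> omega
  obtain ⟨h0, h1, h2, h3⟩ := isCols_iff.1 hp
  rw [isCols_iff] at hs
  by_cases h4 : dropCols p s 0 < dropCols p s 1
  · refine jt_eq_zero_of_sub_eq (show (0 : Fin 4) ≠ 1 by decide) ?_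
    rw [key _ _ h0 h4]
    simp
  by_cases h5 : dropCols p s 1 < dropCols p s 2
  · refine jt_eq_zero_of_sub_eq (show (1 : Fin 4) ≠ 2 by decide) ?_
    rw [key _ _ h1 h5]
    simp
    ring
  by_cases h6 : dropCols p s 2 < dropCols p s 3
  · refine jt_eq_zero_of_sub_eq (show (2 : Fin 4) ≠ 3 by decide) ?_
    rw [key _ _ h2 h6]
    simp
    ring
  · exact jt_eq_zero_of_neg hf (by omega)

theorem schur_ofCols_apply_zero {p : Fin 4 → ℤ} (hp : IsCols p) :
    schur (ofCols p) 0 = if p 0 = 0 then 1 else 0 := by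
  split_ifs with h
  · have hb : (ofCols p).cells = ∅ := by
      refine Finset.eq_empty_of_forall_notMem ?_
      rintro ⟨i, j⟩ hc
      obtain ⟨h1, h2⟩ := (mem_ofCols hp.1).1 ((YoungDiagram.mem_cells _).1 hc)
      have := hp.1 (show (0 : Fin 4) ≤ ⟨j, h1⟩ from Fin.zero_le _)
      omega
    have h0 : type (SemistandardYoungTableau.highestWeight (ofCols p)) = 0 := by
      rw [type, hb, Finset.sum_empty]
    rw [← h0, coeff_self]
  · have h0 : (0, 0) ∈ ofCols p :=
      (mem_ofCols hp.1).2 ⟨by norm_num, lt_of_le_of_ne (hp.nonneg 0) (Ne.symm h)⟩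
    have : IsEmpty {T : SemistandardYoungTableau (ofCols p) // type T = 0} :=
      ⟨fun T => by simpa using entry_lt (n := 0) (by rw [T.2]; simp) h0⟩
    simp [schur]

theorem trunc_zero_schur {p : Fin 4 → ℤ} (hp : IsCols p) :
    trunc 0 (schur (ofCols p)) = if p 0 = 0 then 1 else 0 := by
  ext α
  rw [coeff_trunc]
  have hα : α.support ⊆ Finset.range 0 ↔ α = 0 := by simp
  by_cases h : α = 0
  · rw [if_pos (hα.2 h), h, schur_ofCols_apply_zero hp]
    split_ifs <;> simp
  · rw [if_neg (mt hα.1 h)]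
    split_ifs
    · rw [MvPowerSeries.coeff_one, if_neg h]
    · simp

theorem trunc_zero_e (r : ℤ) : trunc 0 (e r) = if r = 0 then 1 else 0 := by
  rcases lt_or_ge r 0 with hr | hr
  · rw [e_of_neg hr, if_neg hr.ne, map_zero]
  · rw [e, if_neg hr.not_gt, trunc_zero_schur (isCols_iff.2 (by simp [hr]))]
    rfl

theorem trunc_schur_eq_trunc_jt (n : ℕ) {p : Fin 4 → ℤ} (hp : IsCols p) :
    trunc n (schur (ofCols p)) = trunc n (jt e p) := by
  classical
  induction n generalizing p with
  | zero =>
    rw [trunc_zero_schur hp, map_jt]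
    simp only [trunc_zero_e]
    split_ifs with h
    -- With no variables left, `e` is the indicator of 0: the empty shape gives the identity matrix,
    -- while `0 < p 0` gives a zero first row.
    · have h1 : ∀ i, p i = 0 := fun i =>
        le_antisymm (h ▸ hp.1 (Fin.zero_le i)) (hp.nonneg i)
      refine Matrix.det_one.symm.trans (congrArg Matrix.det ?_)
      ext1 i j
      rw [Matrix.of_apply, h1, Matrix.one_apply]
      refine if_congr ?_ rfl rfl
      rw [Fin.ext_iff]
      omega
    · symm
      refine Matrix.det_eq_zero_of_row_eq_zero 0 fun j => ?_
      have h0 := hp.nonneg 0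
      refine if_neg ?_
      simp only [Fin.coe_ofNat_eq_mod]
      omega
  | succ n ih =>
    rw [trunc_succ_schur hp, map_jt, jt_add (trunc_succ_e n)]
    refine Finset.sum_congr rfl fun s _ => ?_
    split_ifs with hs
    · rw [ih hs, map_jt]
    · rw [jt_dropCols_eq_zero (fun r hr => by rw [e_of_neg hr, map_zero]) hp hs, mul_zero]

theorem schur_ofCols {p : Fin 4 → ℤ} (hp : IsCols p) : schur (ofCols p) = jt e p :=
  eq_of_trunc_eq fun n => trunc_schur_eq_trunc_jt n hp

theorem e_zero : e 0 = 1 := by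
  refine eq_of_trunc_eq fun n => ?_
  induction n with
  | zero => rw [trunc_zero_e, if_pos rfl, map_one]
  | succ n ih => rw [trunc_succ_e, ih, e_of_neg (by norm_num : (0 : ℤ) - 1 < 0)]; simp

/-! ### Multiset descriptions of diagrams -/

/-- Passage to the conjugate partition: column `j` has as many squares as there are parts exceeding
`j`. -/
theorem exists_lt_getElem_iff {w : List ℕ} (hw : w.SortedGE) (i j : ℕ) :
    (∃ h : i < w.length, j < w[i]) ↔ i < w.countP (j < ·) := by
  induction w generalizing i with
  | nil => simp
  | cons a w ih =>
    have hw' := hw.pairwise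
    rw [List.pairwise_cons] at hw'
    rw [List.countP_cons]
    by_cases ha : j < a
    · cases i with
      | zero => simp [ha]
      | succ i =>
        have := ih hw'.2.sortedGE i
        simpa [ha] using this
    · have h0 : w.countP (j < ·) = 0 := by
        rw [List.countP_eq_zero]
        intro b hb
        have := hw'.1 b hb
        simp
        omega
      cases i with
      | zero => simp [ha, h0]
      | succ i =>
        have := ih hw'.2.sortedGE i
        simpa [ha, h0] using this

theorem mem_diagram {s : Multiset ℕ} {i j : ℕ} : (i, j) ∈ diagram s ↔ i < s.countP (j < ·) := by
  rw [diagram, YoungDiagram.mem_ofRowLens]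
  refine (exists_lt_getElem_iff (s.pairwise_sort (· ≥ ·)).sortedGE i j).trans ?_
  rw [← Multiset.coe_countP, Multiset.sort_eq]

theorem mem_iff_lt_countP {l : YoungDiagram} {i j : ℕ} :
    (i, j) ∈ l ↔ i < (parts l).countP (j < ·) := by
  conv_lhs => rw [← YoungDiagram.ofRowLens_to_rowLens_eq_self (μ := l)]
  rw [YoungDiagram.mem_ofRowLens, parts, Multiset.coe_countP]
  exact exists_lt_getElem_iff l.rowLens_sorted i j

theorem countP_parts_ofCols {p : Fin 4 → ℤ} (hp : IsCols p) (j : ℕ) :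
    (((parts (ofCols p)).countP (j < ·) : ℕ) : ℤ) = if h : j < 4 then p ⟨j, h⟩ else 0 := by
  have h1 : ∀ i : ℕ, i < (parts (ofCols p)).countP (j < ·) ↔
      i < (if h : j < 4 then p ⟨j, h⟩ else 0).toNat := by
    intro i
    rw [← mem_iff_lt_countP, mem_ofCols hp.1]
    split_ifs with h
    · simp [h]
    · simp [h]
  have h2 : 0 ≤ if h : j < 4 then p ⟨j, h⟩ else 0 := by
    split_ifs
    · exact hp.nonneg _
    · exact le_rfl
  have h3 := eq_of_forall_lt_iff h1
  omega

theorem diagram_eq_ofCols {s : Multiset ℕ} {p : Fin 4 → ℤ} (hp : IsCols p)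
    (h : ∀ j : ℕ, ((s.countP (j < ·) : ℕ) : ℤ) = if h : j < 4 then p ⟨j, h⟩ else 0) :
    diagram s = ofCols p := by
  ext ⟨i, j⟩
  rw [YoungDiagram.mem_cells, YoungDiagram.mem_cells, mem_diagram, mem_iff_lt_countP]
  have := (h j).trans (countP_parts_ofCols hp j).symm
  omega

theorem countP_parts_diagram (s : Multiset ℕ) (j : ℕ) :
    (parts (diagram s)).countP (j < ·) = s.countP (j < ·) :=
  eq_of_forall_lt_iff fun i => by rw [← mem_iff_lt_countP, mem_diagram]

theorem union_ofCols_two {p : Fin 4 → ℤ} (hp : IsCols p) :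
    union (ofCols p) (diagram {2}) = ofCols (p + ![1, 1, 0, 0]) := by
  obtain ⟨h0, h1, h2, h3⟩ := isCols_iff.1 hp
  have hp' : IsCols (p + ![1, 1, 0, 0]) := by
    rw [isCols_iff]
    simp
    omega
  refine diagram_eq_ofCols hp' fun j => ?_
  rw [Multiset.countP_add, Nat.cast_add, countP_parts_ofCols hp, countP_parts_diagram]
  by_cases h : j < 4
  · rw [dif_pos h, dif_pos h]
    interval_cases j <;> simp [Multiset.countP_eq_card_filter, Multiset.filter_singleton]
  · rw [dif_neg h, dif_neg h]
    simp [Multiset.countP_eq_card_filter, Multiset.filter_singleton]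
    omega

/-! ### Two-column products and the operator `Δ^(2)` -/

/-- `y` is the image of the symmetric function `x` under `Δ^(2)`. -/
def IsDelta (x y : MvPowerSeries ℕ ℤ) : Prop :=
  ∃ h : x ∈ Sym, y = (Delta (diagram {2}) ⟨x, h⟩ : Sym)

theorem isDelta_iff {x y : MvPowerSeries ℕ ℤ} :
    IsDelta x y ↔ ∃ z : Sym, z = x ∧ y = (Delta (diagram {2}) z : Sym) := by
  constructor
  · rintro ⟨h, h'⟩
    exact ⟨⟨x, h⟩, rfl, h'⟩
  · rintro ⟨z, rfl, h⟩
    exact ⟨z.2, h⟩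

theorem IsDelta.zero : IsDelta 0 0 := by
  refine isDelta_iff.2 ⟨0, rfl, ?_⟩
  rw [map_zero, ZeroMemClass.coe_zero]

theorem IsDelta.add {x y x' y' : MvPowerSeries ℕ ℤ} (h : IsDelta x y) (h' : IsDelta x' y') :
    IsDelta (x + x') (y + y') := by
  obtain ⟨z, rfl, rfl⟩ := isDelta_iff.1 h
  obtain ⟨z', rfl, rfl⟩ := isDelta_iff.1 h'
  refine isDelta_iff.2 ⟨z + z', rfl, ?_⟩
  rw [map_add, Submodule.coe_add]

theorem IsDelta.neg {x y : MvPowerSeries ℕ ℤ} (h : IsDelta x y) : IsDelta (-x) (-y) := by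
  obtain ⟨z, rfl, rfl⟩ := isDelta_iff.1 h
  refine isDelta_iff.2 ⟨-z, rfl, ?_⟩
  rw [map_neg, Submodule.coe_neg]

theorem IsDelta.sub {x y x' y' : MvPowerSeries ℕ ℤ} (h : IsDelta x y) (h' : IsDelta x' y') :
    IsDelta (x - x') (y - y') := by
  rw [sub_eq_add_neg, sub_eq_add_neg]
  exact h.add h'.neg

theorem isDelta_schur (l : YoungDiagram) :
    IsDelta (schur l) (schur (union l (diagram {2}))) := by
  have h : (⟨schur l, Submodule.subset_span ⟨l, rfl⟩⟩ : Sym) = schurBasis l :=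
    Subtype.ext (schurBasis_apply l).symm
  refine ⟨Submodule.subset_span ⟨l, rfl⟩, ?_⟩
  rw [h, Delta_schurBasis, schurBasis_apply]

theorem isDelta_jt_of_isCols {p : Fin 4 → ℤ} (hp : IsCols p) :
    IsDelta (jt e p) (jt e (p + ![1, 1, 0, 0])) := by
  have hp' : IsCols (p + ![1, 1, 0, 0]) := by
    rw [isCols_iff] at hp ⊢
    simp
    omega
  rw [← schur_ofCols hp, ← schur_ofCols hp', ← union_ofCols_two hp]
  exact isDelta_schur _

/-! ### Small determinants and raising operators -/

section Determinants

variable {R : Type*} [CommRing R] (f : ℤ → R)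

/-- The determinant of the dual Jacobi–Trudi identity for two columns. -/
def jt₂ (a b : ℤ) : R := f a * f b - f (a + 1) * f (b - 1)

/-- The determinant of the dual Jacobi–Trudi identity for three columns. -/
def jt₃ (a b c : ℤ) : R :=
  f a * (f b * f c - f (b + 1) * f (c - 1)) - f (a + 1) * (f (b - 1) * f c - f (b + 1) * f (c - 2))
    + f (a + 2) * (f (b - 1) * f (c - 1) - f b * f (c - 2))

theorem jt_eq (p : Fin 4 → ℤ) : jt f p =
    f (p 0) * (f (p 1) * (f (p 2) * f (p 3) - f (p 2 + 1) * f (p 3 - 1))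
        - f (p 1 + 1) * (f (p 2 - 1) * f (p 3) - f (p 2 + 1) * f (p 3 - 2))
        + f (p 1 + 2) * (f (p 2 - 1) * f (p 3 - 1) - f (p 2) * f (p 3 - 2)))
      - f (p 0 + 1) * (f (p 1 - 1) * (f (p 2) * f (p 3) - f (p 2 + 1) * f (p 3 - 1))
        - f (p 1 + 1) * (f (p 2 - 2) * f (p 3) - f (p 2 + 1) * f (p 3 - 3))
        + f (p 1 + 2) * (f (p 2 - 2) * f (p 3 - 1) - f (p 2) * f (p 3 - 3)))
      + f (p 0 + 2) * (f (p 1 - 1) * (f (p 2 - 1) * f (p 3) - f (p 2 + 1) * f (p 3 - 2))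
        - f (p 1) * (f (p 2 - 2) * f (p 3) - f (p 2 + 1) * f (p 3 - 3))
        + f (p 1 + 2) * (f (p 2 - 2) * f (p 3 - 2) - f (p 2 - 1) * f (p 3 - 3)))
      - f (p 0 + 3) * (f (p 1 - 1) * (f (p 2 - 1) * f (p 3 - 1) - f (p 2) * f (p 3 - 2))
        - f (p 1) * (f (p 2 - 2) * f (p 3 - 1) - f (p 2) * f (p 3 - 3))
        + f (p 1 + 1) * (f (p 2 - 2) * f (p 3 - 2) - f (p 2 - 1) * f (p 3 - 3))) := by
  simp [jt, Matrix.det_succ_row_zero, Fin.sum_univ_succ, Fin.succAbove]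
  ring_nf

/-- The rows depend only on `p i - i`, and these two vectors differ by exchanging the first two
rows. -/
theorem jt_swap_left (a b c d : ℤ) : jt f ![a, b, c, d] = -jt f ![b - 1, a + 1, c, d] := by
  simp only [jt_eq, Matrix.cons_val]
  ring_nf

theorem jt_swap_right (a b c d : ℤ) : jt f ![a, b, c, d] = -jt f ![a, b, d - 1, c + 1] := by
  simp only [jt_eq, Matrix.cons_val]
  ring_nf

/-- The difference of a function on exponent vectors and its translate by `v`. -/
def diff (v : Fin 4 → ℤ) (G : (Fin 4 → ℤ) → R) (α : Fin 4 → ℤ) : R := G α - G (α + v)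

/-- Of the six factors 1 - R_ij (i < j) that build the determinant from a product of four `f`s, the
two inside the pairs {0,1} and {2,3} give the `jt₂`s; the four mixed ones remain as differences. -/
theorem jt_eq_diff_mul_jt₂ : jt f = diff ![1, 0, 0, -1] (diff ![0, 1, 0, -1]
    (diff ![1, 0, -1, 0] (diff ![0, 1, -1, 0] fun α => jt₂ f (α 0) (α 1) * jt₂ f (α 2) (α 3)))) := by
  ext α
  simp only [jt_eq, diff, jt₂, Pi.add_apply, Matrix.cons_val]
  ring_nf

theorem jt_eq_diff_jt₃ : jt f = diff ![1, 0, 0, -1] (diff ![0, 1, 0, -1] (diff ![0, 0, 1, -1]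
    fun α => jt₃ f (α 0) (α 1) (α 2) * f (α 3))) := by
  ext α
  simp only [jt_eq, diff, jt₃, Pi.add_apply, Matrix.cons_val]
  ring_nf

end Determinants

/-- The last two entries are straightened by a row exchange, which does not touch the first two and
so commutes with adding (1,1,0,0). The bound `d ≤ b` keeps the exchanged vector a partition when its
last entry is nonnegative. -/
theorem isDelta_jt_of_le {a b c d : ℤ} (hba : b ≤ a) (hcb : c ≤ b) (hdb : d ≤ b) :
    IsDelta (jt e ![a, b, c, d]) (jt e ![a + 1, b + 1, c, d]) := by
  have key : ∀ c d : ℤ, c ≤ b → d ≤ c →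
      IsDelta (jt e ![a, b, c, d]) (jt e ![a + 1, b + 1, c, d]) := by
    intro c d hcb hdc
    rcases lt_or_ge d 0 with hd | hd
    · rw [jt_eq_zero_of_neg (fun _ => e_of_neg) (by exact hd),
        jt_eq_zero_of_neg (fun _ => e_of_neg) (by exact hd)]
      exact IsDelta.zero
    · have := isDelta_jt_of_isCols (p := ![a, b, c, d]) (isCols_iff.2 ⟨hba, hcb, hdc, hd⟩)
      simpa using this
  rcases le_or_gt d c with h | h
  · exact key c d hcb h
  rcases eq_or_ne (c + 1) d with rfl | h'
  · have h0 : ∀ a b : ℤ, jt e ![a, b, c, c + 1] = 0 := fun a b =>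
      jt_eq_zero_of_sub_eq (i := 2) (i' := 3) (by decide) (by simp; ring)
    rw [h0, h0]
    exact IsDelta.zero
  · rw [jt_swap_right, jt_swap_right e (a + 1)]
    exact (key (d - 1) (c + 1) (by omega) (by omega)).neg

theorem isDelta_jt {a b c d M : ℤ} (ha : M ≤ a) (hb : M ≤ b) (hc : c ≤ M) (hd : d ≤ M) :
    IsDelta (jt e ![a, b, c, d]) (jt e ![a + 1, b + 1, c, d]) := by
  rcases le_or_gt b a with h | h
  · exact isDelta_jt_of_le h (hc.trans hb) (hd.trans hb)
  rcases eq_or_ne (a + 1) b with rfl | h'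
  · have h0 : ∀ a : ℤ, jt e ![a, a + 1, c, d] = 0 := fun a =>
      jt_eq_zero_of_sub_eq (i := 0) (i' := 1) (by decide) (by simp)
    rw [h0, h0]
    exact IsDelta.zero
  · rw [jt_swap_left, jt_swap_left e (a + 1), show b + 1 - 1 = b - 1 + 1 by ring]
    exact (isDelta_jt_of_le (by omega) (by omega) (by omega)).neg

theorem isDelta_jt_apply {α : Fin 4 → ℤ} {M : ℤ} (h0 : M ≤ α 0) (h1 : M ≤ α 1) (h2 : α 2 ≤ M)
    (h3 : α 3 ≤ M) : IsDelta (jt e α) (jt e (α + ![1, 1, 0, 0])) := by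
  have h : α = ![α 0, α 1, α 2, α 3] := by
    ext i
    fin_cases i <;> rfl
  have := isDelta_jt h0 h1 h2 h3
  rw [← h] at this
  convert this using 2
  rw [h]
  simp

/-- To compute `Δ^(2)` on the values of `G` it suffices to do so on the differences of `G` along
a direction in which `G` vanishes eventually. -/
theorem isDelta_of_diff {G : (Fin 4 → ℤ) → MvPowerSeries ℕ ℤ} {v : Fin 4 → ℤ} (k : Fin 4)
    (hv : v k = -1) (hG : ∀ α, α k < -1 → G α = 0) {P : (Fin 4 → ℤ) → Prop}
    (hP : ∀ α, P α → P (α + v))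
    (h : ∀ α, P α → IsDelta (diff v G α) (diff v G (α + ![1, 1, 0, 0])))
    (hk : (![1, 1, 0, 0] : Fin 4 → ℤ) k = 0) {α : Fin 4 → ℤ} (hα : P α) :
    IsDelta (G α) (G (α + ![1, 1, 0, 0])) := by
  have key : ∀ N : ℕ, ∀ α, P α → α k < -1 + N → IsDelta (G α) (G (α + ![1, 1, 0, 0])) := by
    intro N
    induction N with
    | zero =>
      intro α _ hα
      rw [hG α (by simpa using hα), hG _ (by rw [Pi.add_apply, hk]; simpa using hα)]
      exact IsDelta.zero
    | succ N ih =>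
      intro α hα hN
      have h1 := ih (α + v) (hP α hα) (by rw [Pi.add_apply, hv]; push_cast at hN; omega)
      have h2 := (h α hα).add h1
      -- Telescoping: G α = `diff v G α` + G (α + v), and coordinate `k` of α + v is smaller by one.
      rw [diff, diff, add_right_comm α v, sub_add_cancel, sub_add_cancel] at h2
      exact h2
  exact key (α k + 2).toNat α hα (by omega)

theorem diff_eq_zero {R : Type*} [CommRing R] {G : (Fin 4 → ℤ) → R} {k : Fin 4}
    (hG : ∀ α, α k < -1 → G α = 0) {v : Fin 4 → ℤ} (hv : v k ≤ 0) (α : Fin 4 → ℤ)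
    (hα : α k < -1) : diff v G α = 0 := by
  rw [diff, hG α hα, hG _ (by rw [Pi.add_apply]; omega), sub_zero]

/-- The bound is -1 and not 0 because `a = -1` leaves the term with `e 0`; this is why the vanishing
condition throughout is `α k < -1`. -/
theorem jt₂_eq_zero_left {a b : ℤ} (ha : a < -1) : jt₂ e a b = 0 := by
  rw [jt₂, e_of_neg (by omega : a < 0), e_of_neg (by omega : a + 1 < 0)]
  simp

theorem jt₂_eq_zero_right {a b : ℤ} (hb : b < 0) : jt₂ e a b = 0 := by
  rw [jt₂, e_of_neg hb, e_of_neg (by omega : b - 1 < 0)]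
  simp

theorem isDelta_jt₂_mul_jt₂ {a b c d : ℤ} (M : ℤ) (ha : M ≤ a) (hb : M ≤ b) (hc : c ≤ M)
    (hd : d ≤ M) : IsDelta (jt₂ e a b * jt₂ e c d) (jt₂ e (a + 1) (b + 1) * jt₂ e c d) := by
  let P : (Fin 4 → ℤ) → Prop := fun α => M ≤ α 0 ∧ M ≤ α 1 ∧ α 2 ≤ M ∧ α 3 ≤ M
  let G : (Fin 4 → ℤ) → MvPowerSeries ℕ ℤ := fun α => jt₂ e (α 0) (α 1) * jt₂ e (α 2) (α 3)
  have hG2 : ∀ α, α 2 < -1 → G α = 0 := fun α h => by simp [G, jt₂_eq_zero_left h]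
  have hG3 : ∀ α, α 3 < -1 → G α = 0 := fun α h => by
    simp [G, jt₂_eq_zero_right (h.trans (by norm_num))]
  have hP : ∀ v : Fin 4 → ℤ, 0 ≤ v 0 → 0 ≤ v 1 → v 2 ≤ 0 → v 3 ≤ 0 → ∀ α, P α → P (α + v) := by
    rintro v h0 h1 h2 h3 α ⟨h4, h5, h6, h7⟩
    simp only [P, Pi.add_apply]
    omega
  have h5 : ∀ α, P α → IsDelta (jt e α) (jt e (α + ![1, 1, 0, 0])) :=
    fun α hα => isDelta_jt_apply hα.1 hα.2.1 hα.2.2.1 hα.2.2.2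
  -- The four differences are now removed, outermost first. Each raises one of the first two entries
  -- and lowers one of the last two, so `P` is preserved.
  rw [jt_eq_diff_mul_jt₂] at h5
  have h4 : ∀ α, P α → _ := fun α hα => isDelta_of_diff 3 (by simp)
    (diff_eq_zero (diff_eq_zero (diff_eq_zero hG3 (by simp)) (by simp)) (by simp))
    (hP _ (by simp) (by simp) (by simp) (by simp)) h5 (by simp) hα
  have h3 : ∀ α, P α → _ := fun α hα => isDelta_of_diff 3 (by simp)
    (diff_eq_zero (diff_eq_zero hG3 (by simp)) (by simp))
    (hP _ (by simp) (by simp) (by simp) (by simp)) h4 (by simp) hα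
  have h2 : ∀ α, P α → _ := fun α hα => isDelta_of_diff 2 (by simp)
    (diff_eq_zero hG2 (by simp)) (hP _ (by simp) (by simp) (by simp) (by simp)) h3 (by simp) hα
  have h1 := isDelta_of_diff (G := G) (α := ![a, b, c, d]) 2 (by simp) hG2
    (hP _ (by simp) (by simp) (by simp) (by simp)) h2 (by simp) ⟨ha, hb, hc, hd⟩
  simpa [G] using h1

/-- Only the outermost difference is inverted: the shift by (0,0,1,-1) would push the third entry
above `k`. The other two differences are written out, and the `jt₃`s with equal rows cancel. At
(k,k,k,d) one product is left, at (k+1,k+1,k,d) two, because the third column may now grow. -/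
theorem isDelta_jt₃_mul_e {k d : ℤ} (hd : d ≤ k) : IsDelta (jt₃ e k k k * e d)
    (jt₃ e (k + 1) (k + 1) k * e d - jt₃ e (k + 1) (k + 1) (k + 1) * e (d - 1)) := by
  let P : (Fin 4 → ℤ) → Prop := fun α => k ≤ α 0 ∧ α 1 = k ∧ α 2 = k ∧ α 3 ≤ k
  have hG : ∀ α : Fin 4 → ℤ, α 3 < -1 → jt₃ e (α 0) (α 1) (α 2) * e (α 3) = 0 := fun α h => by
    rw [e_of_neg (h.trans (by norm_num)), mul_zero]
  have h2 : ∀ α, P α → IsDelta (jt e α) (jt e (α + ![1, 1, 0, 0])) :=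
    fun α hα => isDelta_jt_apply hα.1 hα.2.1.ge hα.2.2.1.le hα.2.2.2
  rw [jt_eq_diff_jt₃] at h2
  have h1 := isDelta_of_diff (P := P) (α := ![k, k, k, d]) 3 (by simp)
    (diff_eq_zero (diff_eq_zero hG (by simp)) (by simp)) (by
      rintro α ⟨h4, h5, h6, h7⟩
      simp only [P, Pi.add_apply, Matrix.cons_val]
      omega) h2 (by simp) ⟨le_rfl, rfl, rfl, hd⟩
  convert h1 using 1
  · simp only [diff, jt₃, Pi.add_apply, Matrix.cons_val]
    ring_nf
  · simp only [diff, jt₃, Pi.add_apply, Matrix.cons_val]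
    ring_nf

/-! ### The main theorem -/

theorem jt_e_zero_zero (a b : ℤ) : jt e ![a, b, 0, 0] = jt₂ e a b := by
  have h1 : e (-1) = 0 := e_of_neg (by norm_num)
  have h2 : e (-2) = 0 := e_of_neg (by norm_num)
  have h3 : e (-3) = 0 := e_of_neg (by norm_num)
  simp [jt_eq, jt₂, e_zero, h1, h2, h3]

theorem jt_e_zero (a b c : ℤ) : jt e ![a, b, c, 0] = jt₃ e a b c := by
  have h1 : e (-1) = 0 := e_of_neg (by norm_num)
  have h2 : e (-2) = 0 := e_of_neg (by norm_num)
  have h3 : e (-3) = 0 := e_of_neg (by norm_num)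
  simp [jt_eq, jt₃, e_zero, h1, h2, h3]

theorem countP_lt_replicate (j c n : ℕ) :
    (Multiset.replicate n c).countP (j < ·) = if j < c then n else 0 := by
  rw [← Multiset.coe_replicate, Multiset.coe_countP, List.countP_replicate]
  simp

/-- The determinant agrees with the zero convention only under `h`: for `b < 0 < a` it need not
vanish. The alternative `a ≤ 0` is needed for `s_{(1^{k-2})}` with `k < 2`. -/
theorem sTwoOne_eq {a b : ℤ} (h : 0 ≤ b ∨ a ≤ 0) : sTwoOne a b = jt₂ e (a + b) a := by
  rw [sTwoOne]
  split_ifs with h'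
  · rcases lt_or_ge a 0 with ha | ha
    · rw [jt₂_eq_zero_right ha]
    · have h0 : a = 0 := by omega
      rw [jt₂, e_of_neg (by omega : a + b < 0), e_of_neg (by omega : a - 1 < 0)]
      simp
  · have hp : IsCols ![a + b, a, 0, 0] := by
      rw [isCols_iff]
      simp
      omega
    rw [← jt_e_zero_zero, ← schur_ofCols hp]
    congr 1
    refine diagram_eq_ofCols hp fun j => ?_
    simp only [Multiset.countP_add, countP_lt_replicate]
    by_cases h : j < 4
    · rw [dif_pos h]
      interval_cases j <;> simp <;> omega
    · rw [dif_neg h, if_neg (by omega), if_neg (by omega)]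
      rfl

theorem sRect_three (k : ℕ) : sRect 3 k = jt₃ e k k k := by
  have hp : IsCols ![(k : ℤ), k, k, 0] := by
    rw [isCols_iff]
    simp
  rw [← jt_e_zero, ← schur_ofCols hp, sRect]
  congr 1
  refine diagram_eq_ofCols hp fun j => ?_
  rw [countP_lt_replicate]
  by_cases h : j < 4
  · rw [dif_pos h]
    interval_cases j <;> simp
  · rw [dif_neg h, if_neg (by omega)]
    rfl

theorem sRect_four (k : ℕ) : sRect 4 k = jt e ![(k : ℤ), k, k, k] := by
  have hp : IsCols ![(k : ℤ), k, k, k] := by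
    rw [isCols_iff]
    simp
  rw [← schur_ofCols hp, sRect]
  congr 1
  refine diagram_eq_ofCols hp fun j => ?_
  rw [countP_lt_replicate]
  by_cases h : j < 4
  · rw [dif_pos h]
    interval_cases j <;> simp
  · rw [dif_neg h, if_neg (by omega)]
    rfl

theorem sTwoOne_zero (b : ℤ) : sTwoOne 0 b = e b := by
  rw [sTwoOne_eq (Or.inr le_rfl), jt₂, e_zero, e_of_neg (by norm_num : (0 : ℤ) - 1 < 0)]
  simp

theorem D_eq {m i : ℕ} {j n : ℤ} (hj : (i : ℤ) = j) (hn : (m : ℤ) - i - 1 = n) :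
    D m i = (jt₂ e j j + jt₂ e (j + 1) (j - 1)) * jt₂ e n n - jt₂ e j (j - 1) * jt₂ e (n + 1) n := by
  rw [D, hn, hj, sTwoOne_eq (Or.inl le_rfl), sTwoOne_eq (Or.inl le_rfl),
    sTwoOne_eq (Or.inl (by norm_num)), sTwoOne_eq (Or.inl (by norm_num)),
    sTwoOne_eq (Or.inl (by norm_num)), add_zero, add_zero, sub_add_cancel,
    show j - 1 + 2 = j + 1 by ring]
  ring

/-- The factors with index `n` are the long ones; `M = n` separates the columns in all three
products, the tightest being `i + 1 ≤ n` in the second. -/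
theorem isDelta_D_right {i n : ℤ} (h : i + 1 ≤ n) :
    IsDelta ((jt₂ e i i + jt₂ e (i + 1) (i - 1)) * jt₂ e n n - jt₂ e i (i - 1) * jt₂ e (n + 1) n)
      ((jt₂ e i i + jt₂ e (i + 1) (i - 1)) * jt₂ e (n + 1) (n + 1)
        - jt₂ e i (i - 1) * jt₂ e (n + 1 + 1) (n + 1)) := by
  have h1 := isDelta_jt₂_mul_jt₂ (a := n) (b := n) (c := i) (d := i) n le_rfl le_rfl
    (by omega) (by omega)
  have h2 := isDelta_jt₂_mul_jt₂ (a := n) (b := n) (c := i + 1) (d := i - 1) n le_rfl le_rfl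
    (by omega) (by omega)
  have h3 := isDelta_jt₂_mul_jt₂ (a := n + 1) (b := n) (c := i) (d := i - 1) n (by omega) le_rfl
    (by omega) (by omega)
  convert (h1.add h2).sub h3 using 1 <;> ring

/-- Here the factors with index `i` are long. The third product has columns `i - 1` and `n + 1`
facing each other, whence `n + 2 ≤ i`. -/
theorem isDelta_D_left {i n : ℤ} (h : n + 2 ≤ i) :
    IsDelta ((jt₂ e i i + jt₂ e (i + 1) (i - 1)) * jt₂ e n n - jt₂ e i (i - 1) * jt₂ e (n + 1) n)
      ((jt₂ e (i + 1) (i + 1) + jt₂ e (i + 1 + 1) (i + 1 - 1)) * jt₂ e n n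
        - jt₂ e (i + 1) (i + 1 - 1) * jt₂ e (n + 1) n) := by
  have h1 := isDelta_jt₂_mul_jt₂ (a := i) (b := i) (c := n) (d := n) i le_rfl le_rfl
    (by omega) (by omega)
  have h2 := isDelta_jt₂_mul_jt₂ (a := i + 1) (b := i - 1) (c := n) (d := n) (i - 1)
    (by omega) le_rfl (by omega) (by omega)
  have h3 := isDelta_jt₂_mul_jt₂ (a := i) (b := i - 1) (c := n + 1) (d := n) (i - 1) (by omega)
    le_rfl (by omega) (by omega)
  rw [show i - 1 + 1 = i + 1 - 1 by ring] at h2 h3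
  convert (h1.add h2).sub h3 using 1 <;> ring

section Identities

variable {R : Type*} [CommRing R] (f : ℤ → R) (k : ℤ)

theorem jt₂_identity_center : (jt₂ f k k + jt₂ f (k + 1) (k - 1)) * jt₂ f k k
    - jt₂ f k (k - 1) * jt₂ f (k + 1) k = jt₃ f k k k * f k := by
  simp only [jt₂, jt₃]
  ring_nf

theorem jt₂_identity_succ : (jt₂ f (k + 1) (k + 1) + jt₂ f (k + 1 + 1) (k + 1 - 1)) *
      jt₂ f (k - 1) (k - 1) - jt₂ f (k + 1) (k + 1 - 1) * jt₂ f (k - 1 + 1) (k - 1) =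
    jt f ![k, k, k, k] - jt₃ f k k k * f k - (jt₃ f (k + 1) (k + 1) k * f (k - 2)
      - jt₃ f (k + 1) (k + 1) (k + 1) * f (k - 2 - 1)) := by
  simp only [jt_eq, jt₂, jt₃, Matrix.cons_val]
  ring_nf

end Identities

end SchurFn
end

theorem mainTheorem8 (k m : ℕ) (hm : m = 2 * k + 1) :
    (SchurFn.D m k = SchurFn.sRect 3 k * SchurFn.sTwoOne 0 k) ∧
    (∃ h : SchurFn.sRect 3 k * SchurFn.sTwoOne 0 ((k : ℤ) - 2) ∈ SchurFn.Sym,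
      SchurFn.D m (k + 1) =
        SchurFn.sRect 4 k - SchurFn.sRect 3 k * SchurFn.sTwoOne 0 k
          - (SchurFn.Delta (SchurFn.diagram {2})
              ⟨SchurFn.sRect 3 k * SchurFn.sTwoOne 0 ((k : ℤ) - 2), h⟩ : SchurFn.Sym)) ∧
    (∀ i : ℕ, i < k →
      (∃ h : SchurFn.D (m - 1) i ∈ SchurFn.Sym,
        SchurFn.D m i =
          (SchurFn.Delta (SchurFn.diagram {2}) ⟨SchurFn.D (m - 1) i, h⟩ : SchurFn.Sym)) ∧
      (∃ h : SchurFn.D (m - 1) (m - 1 - i) ∈ SchurFn.Sym,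
        SchurFn.D m (m - i) =
          (SchurFn.Delta (SchurFn.diagram {2})
            ⟨SchurFn.D (m - 1) (m - 1 - i), h⟩ : SchurFn.Sym))) := by
  subst hm
  refine ⟨?_, ?_, fun i hi => ⟨?_, ?_⟩⟩
  · rw [SchurFn.D_eq rfl (n := k) (by push_cast; ring), SchurFn.jt₂_identity_center,
      SchurFn.sRect_three, SchurFn.sTwoOne_zero]
  · obtain ⟨h, h'⟩ := SchurFn.isDelta_jt₃_mul_e (k := k) (d := (k : ℤ) - 2) (by omega)
    rw [← SchurFn.sRect_three, ← SchurFn.sTwoOne_zero] at h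
    refine ⟨h, ?_⟩
    simp only [SchurFn.sRect_three, SchurFn.sTwoOne_zero, SchurFn.sRect_four]
    rw [← h', SchurFn.D_eq (j := (k : ℤ) + 1) (by push_cast; rfl) (n := (k : ℤ) - 1)
      (by push_cast; ring), SchurFn.jt₂_identity_succ]
  · have h := SchurFn.isDelta_D_right (i := i) (n := 2 * k - i - 1) (by omega)
    rwa [← SchurFn.D_eq (m := 2 * k + 1 - 1) rfl (by push_cast; ring),
      ← SchurFn.D_eq (m := 2 * k + 1) rfl (by push_cast; ring)] at h
  -- For `i = 0` the short index is -1, where both the convention and the determinants give zero.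
  · have h := SchurFn.isDelta_D_left (i := 2 * k - i) (n := i - 1) (by omega)
    rwa [← SchurFn.D_eq (m := 2 * k + 1 - 1) (i := 2 * k + 1 - 1 - i) (by omega) (by omega),
      ← SchurFn.D_eq (m := 2 * k + 1) (i := 2 * k + 1 - i) (by omega) (by omega)] at h
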